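/- For a positive integer $n$ let $\Omega_n=\{0,\pm1,\dots,\pm n\}$ and let $\mathfrak{B}_n$ be the hyperoctahedral group of signed permutations, i.e. of bijections $\pi:\Omega_n\to\Omega_n$ with $\pi(-a)=-\pi(a)$ for all $a\in\Omega_n$; write $\pi_i=\pi(i)$ for $0\le i\le n$, so that $\pi_0=0$. Besides the natural order $<$ on $\mathbb{Z}$ consider the $r$-order $-1<_r-2<_r-3<_r\cdots<_r0<_r1<_r2<_r\cdots$. Put $$\mathrm{des}^B(\pi)=|\{0\le i\le n-1:\pi_i>\pi_{i+1}\}|,\qquad \mathrm{des}_B(\pi)=|\{0\le i\le n-1:\pi_i>_r\pi_{i+1}\}|,$$ $\mathrm{ides}^B(\pi)=\mathrm{des}^B(\pi^{-1})$ and $\mathrm{ides}_B(\pi)=\mathrm{des}_B(\pi^{-1})$. Let $\mathcal{I}_n^B=\{\pi\in\mathfrak{B}_n:\pi^{-1}=\pi\}$ be the set of signed involutions and let $\mathcal{J}_n^B$ be the set of those $\pi\in\mathcal{I}_n^B$ with $\pi(i)\ne i$ and $\pi(i)\neq -i$ for all $1\le i\le n$ (the fixed-point-free signed involutions). Two statistics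 are equidistributed over a finite set $S$ if they take each value equally often on $S$. Then for every positive integer $n$: 1. The pairs $(\mathrm{des}^B,\mathrm{ides}^B)$ and $(\mathrm{des}_B,\mathrm{ides}_B)$ are equidistributed over $\mathfrak{B}_n$, and both define the same two-sided $\mathfrak{B}_n$-Eulerian polynomial: $$\sum_{\pi\in\mathfrak{B}_n}s^{\mathrm{des}^B(\pi)}t^{\mathrm{ides}^B(\pi)}=\sum_{\pi\in\mathfrak{B}_n}s^{\mathrm{des}_B(\pi)}t^{\mathrm{ides}_B(\pi)}\quad\text{in }\mathbb{Z}[s,t].$$ 2. The statistics $\mathrm{des}^B$ and $\mathrm{des}_B$ are equidistributed over $\mathcal{I}_n^B$, and so are the pairs $(\mathrm{des}^B,\mathrm{ides}^B)$ and $(\mathrm{des}_B,\mathrm{ides}_B)$; moreover $$\sum_{\pi\in\mathcal{I}_n^B}t^{\mathrm{des}^B(\pi)}=\sum_{\pi\in\mathcal{I}_n^B}t^{\mathrm{des}_B(\pi)}\quad\text{in }\mathbb{Z}[t].$$ 3. If $n$ is odd, then $\mathcal{J}_n^B=\emptyset$. If $n$ is even, then $\mathrm{des}^B$ and $\mathrm{des}_B$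 are not equidistributed over $\mathcal{J}_n^B$, and neither are the pairs $(\mathrm{des}^B,\mathrm{ides}^B)$ and $(\mathrm{des}_B,\mathrm{ides}_B)$. -/

import Mathlib

/-- The set `Ω_n = {0, 1, -1, 2, -2, …, n, -n}`. -/
abbrev Omega (n : ℕ) : Type := {a : ℤ // -(n : ℤ) ≤ a ∧ a ≤ (n : ℤ)}

instance Omega.instFintype (n : ℕ) : Fintype (Omega n) :=
  Fintype.subtype (@Finset.Icc ℤ Int.instLinearOrder.toPreorder _ (-(n : ℤ)) (n : ℤ))
    (fun _ => Finset.mem_Icc)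

/-- The map `a ↦ -a` on `Ω_n`. -/
instance Omega.instNeg (n : ℕ) : Neg (Omega n) :=
  ⟨fun a => ⟨-a.1, neg_le_neg a.2.2, neg_le.mp a.2.1⟩⟩

/-- The element `i` of `Ω_n`, for `0 ≤ i ≤ n`. -/
def Omega.ofFin {n : ℕ} (i : Fin (n + 1)) : Omega n :=
  ⟨(i.1 : ℤ), by have := i.2; omega, by have := i.2; omega⟩

/-- The hyperoctahedral group `B_n`: the bijections `π : Ω_n → Ω_n` with `π(-a) = -π(a)` for all
`a ∈ Ω_n`, as a subgroup of the group of all permutations of `Ω_n`. -/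
def hyperoctahedral (n : ℕ) : Subgroup (Equiv.Perm (Omega n)) where
  carrier := {π | ∀ a : Omega n, π (-a) = -(π a)}
  mul_mem' := by
    intro π σ hπ hσ a
    rw [Equiv.Perm.mul_apply, Equiv.Perm.mul_apply, hσ, hπ]
  one_mem' := by
    intro a
    rfl
  inv_mem' := by
    intro π hπ a
    rw [Equiv.Perm.inv_eq_iff_eq, hπ]
    exact congrArg Neg.neg (π.apply_symm_apply a).symm

/-- The type of signed permutations of length `n`, i.e. of elements of `B_n`. -/
abbrev SignedPerm (n : ℕ) : Type := hyperoctahedral n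

instance SignedPerm.instFintype (n : ℕ) : Fintype (SignedPerm n) :=
  Subtype.fintype (fun π : Equiv.Perm (Omega n) => ∀ a : Omega n, π (-a) = -(π a))

/-- The entry `π_i = π(i)`, as an integer, for `0 ≤ i ≤ n` (so `π_0 = 0`). -/
def SignedPerm.entry {n : ℕ} (π : SignedPerm n) (i : Fin (n + 1)) : ℤ :=
  (π.1 (Omega.ofFin i)).1

/-- The `r`-order on `ℤ`: `-1 <_r -2 <_r -3 <_r ⋯ <_r 0 <_r 1 <_r 2 <_r ⋯`. -/
def rLT (a b : ℤ) : Prop :=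
  (a < 0 ∧ 0 ≤ b) ∨ (0 ≤ a ∧ a < b) ∨ (a < 0 ∧ b < 0 ∧ b < a)

instance rLT.instDecidable (a b : ℤ) : Decidable (rLT a b) :=
  inferInstanceAs (Decidable ((a < 0 ∧ 0 ≤ b) ∨ (0 ≤ a ∧ a < b) ∨ (a < 0 ∧ b < 0 ∧ b < a)))

namespace SignedPerm

/-- The descent set of `π` under the natural order: the `i ∈ {0, …, n-1}` with
`π_i > π_{i+1}`. -/
def DesNat {n : ℕ} (π : SignedPerm n) : Finset (Fin n) :=
  Finset.univ.filter (fun i => π.entry i.castSucc > π.entry i.succ)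

/-- The descent set of `π` under the `r`-order: the `i ∈ {0, …, n-1}` with
`π_i >_r π_{i+1}`. -/
def DesR {n : ℕ} (π : SignedPerm n) : Finset (Fin n) :=
  Finset.univ.filter (fun i => rLT (π.entry i.succ) (π.entry i.castSucc))

/-- The inverse descent set of `π` under the natural order. -/
def iDesNat {n : ℕ} (π : SignedPerm n) : Finset (Fin n) :=
  Finset.univ.filter (fun i => entry π⁻¹ i.castSucc > entry π⁻¹ i.succ)

/-- The inverse descent set of `π` under the `r`-order. -/
def iDesR {n : ℕ} (π : SignedPerm n) : Finset (Fin n) :=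
  Finset.univ.filter (fun i => rLT (entry π⁻¹ i.succ) (entry π⁻¹ i.castSucc))

/-- `des^B(π)`. -/
def desNat {n : ℕ} (π : SignedPerm n) : ℕ := π.DesNat.card

/-- `des_B(π)`. -/
def desR {n : ℕ} (π : SignedPerm n) : ℕ := π.DesR.card

/-- `ides^B(π)`. -/
def idesNat {n : ℕ} (π : SignedPerm n) : ℕ := π.iDesNat.card

/-- `ides_B(π)`. -/
def idesR {n : ℕ} (π : SignedPerm n) : ℕ := π.iDesR.card

end SignedPerm

/-- The set of signed involutions: the `π ∈ B_n` with `π⁻¹ = π`. -/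
def signedInvolutions (n : ℕ) : Finset (SignedPerm n) :=
  Finset.univ.filter (fun π => π⁻¹ = π)

/-- The set of fixed-point-free signed involutions: the signed involutions `π ∈ B_n` with
`π(i) ≠ i` and `π(i) ≠ -i` for every `i ∈ {1, …, n}`. -/
def fixedPointFreeSignedInvolutions (n : ℕ) : Finset (SignedPerm n) :=
  (signedInvolutions n).filter (fun π =>
    ∀ i : Fin n, π.entry i.succ ≠ (i.1 : ℤ) + 1 ∧ π.entry i.succ ≠ -((i.1 : ℤ) + 1))

/-- Two statistics `f` and `g` are equidistributed over the finite set `S` if they take every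
value equally often on `S`. -/
def Equidistributed {α β : Type*} [DecidableEq β] (S : Finset α) (f g : α → β) : Prop :=
  ∀ v : β, (S.filter (fun x => f x = v)).card = (S.filter (fun x => g x = v)).card

/-- The two-sided Eulerian polynomial `∑_{π ∈ B_n} s^{des^B(π)} t^{ides^B(π)}`, where `s` and `t`
are the variables `X 0` and `X 1`. -/
noncomputable def twoSidedEulerianNat (n : ℕ) : MvPolynomial (Fin 2) ℤ :=
  ∑ π : SignedPerm n, MvPolynomial.X 0 ^ π.desNat * MvPolynomial.X 1 ^ π.idesNat

/-- The polynomial `∑_{π ∈ B_n} s^{des_B(π)} t^{ides_B(π)}`. -/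
noncomputable def twoSidedEulerianR (n : ℕ) : MvPolynomial (Fin 2) ℤ :=
  ∑ π : SignedPerm n, MvPolynomial.X 0 ^ π.desR * MvPolynomial.X 1 ^ π.idesR

/-- The polynomial `∑ t^{des^B(π)}`, over all signed involutions `π ∈ B_n`. -/
noncomputable def involutionEulerianNat (n : ℕ) : Polynomial ℤ :=
  ∑ π ∈ signedInvolutions n, Polynomial.X ^ π.desNat

/-- The polynomial `∑ t^{des_B(π)}`, over all signed involutions `π ∈ B_n`. -/
noncomputable def involutionEulerianR (n : ℕ) : Polynomial ℤ :=
  ∑ π ∈ signedInvolutions n, Polynomial.X ^ π.desR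

/-!
Both orders compare signs first and then sort the positive integers as usual and the negative ones
one way or the other, so they are treated together, with a parameter `ε : ℤˣ`.

The signed permutations with `Des π ⊆ S` and `Des π⁻¹ ⊆ T` are those sorted within each block of
positions cut out by `S`, with inverse sorted within each block cut out by `T`. For either order, a
double coset of the two Young subgroups contains at most one such element, because a finite
sequence has only one sorted rearrangement. If it contains one for one order then it contains one
for the other: the condition at the position `0` only concerns signs, which the Young subgroups
preserve, and an element of maximal `totalWeight` is sorted. Möbius inversion over `(S, T)` gives
the equidistribution of the pairs of descent sets. For `S = T` inversion preserves the double coset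
of an involution, so its sorted element is an involution as well.

If `π` has no fixed point up to sign and is sorted for the `r`-order, then `π` moves every position
to another block up to sign, which is a property of the double coset. Hence the `r`-order has at
most as many fixed-point-free involutions with `Des π = {i}` as the natural order, and for `i = 0`
it has fewer: it has none, whereas the natural order has the one with entries `-n, …, -1`.
-/

theorem comp_perm_eq_of_monotone {α β : Type*} [LinearOrder α] [Finite α] [PartialOrder β]
    {f : α → β} {e : Equiv.Perm α} (hf : Monotone f) (hfe : Monotone (f ∘ e)) : f ∘ e = f := by
  have := Fintype.ofFinite α
  let ι := Fintype.orderIsoFinOfCardEq α rfl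
  have h := Tuple.unique_monotone (f := f ∘ ι) (σ := ι.toEquiv.permCongr.symm e) (τ := 1)
    (by simpa [Function.comp_def] using hfe.comp ι.monotone) (hf.comp ι.monotone)
  funext a
  simpa using congrFun h (ι.symm a)

theorem eqOn_of_monotoneOn_comp_perm {α β : Type*} [LinearOrder α] [PartialOrder β]
    {f : α → β} {e : Equiv.Perm α} {s : Set α} [Finite s] (he : ∀ a, e a ∈ s ↔ a ∈ s)
    (hf : MonotoneOn f s) (hfe : MonotoneOn (f ∘ e) s) : Set.EqOn (f ∘ e) f s := by
  intro a ha
  have hrestrict := comp_perm_eq_of_monotone (e := e.subtypePerm he)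
    (fun x y h => hf x.2 y.2 h) (fun x y h => hfe x.2 y.2 h)
  exact congrFun hrestrict ⟨a, ha⟩

theorem sum_apply_mul_swap {α M : Type*} [Fintype α] [DecidableEq α] [AddCommGroup M]
    (F : α → α → M) (ρ : Equiv.Perm α) {u v : α} (huv : u ≠ v) :
    ∑ a, F a ((ρ * Equiv.swap u v) a) - ∑ a, F a (ρ a) =
      (F u (ρ v) - F u (ρ u)) + (F v (ρ u) - F v (ρ v)) := by
  rw [← Finset.sum_sub_distrib, Fintype.sum_eq_add u v huv]
  · simp
  · rintro a ⟨hu, hv⟩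
    simp [Equiv.swap_apply_of_ne_of_ne hu hv]

theorem card_filter_card_eq_one {α β : Type*} [Fintype β] [DecidableEq β] (s : Finset α)
    (D : α → Finset β) :
    (s.filter fun x => (D x).card = 1).card = ∑ i, (s.filter fun x => D x = {i}).card := by
  classical
  rw [← Finset.card_biUnion]
  · congr 1
    ext x
    simp [Finset.card_eq_one]
  · intro i _ j _ hij
    refine Finset.disjoint_filter.2 fun x _ hi hj => hij ?_
    exact Finset.singleton_injective (hi.symm.trans hj)

theorem equidistributed_of_card_filter_le_eq {α β : Type*} [PartialOrder β] [OrderBot β]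
    [LocallyFiniteOrder β] [DecidableEq β] [DecidableLE β] {S : Finset α} {f g : α → β}
    (h : ∀ v, (S.filter (f · ≤ v)).card = (S.filter (g · ≤ v)).card) : Equidistributed S f g := by
  have card_le_eq_sum (k : α → β) (v : β) : ((S.filter (k · ≤ v)).card : ℤ) =
      ∑ w ∈ Finset.Iic v, ((S.filter (k · = w)).card : ℤ) := by
    rw [Finset.card_eq_sum_card_fiberwise (f := k) (t := Finset.Iic v) (by intro a; simp)]
    push_cast
    refine Finset.sum_congr rfl fun w hw => ?_
    rw [Finset.filter_filter]
    congr 2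
    refine Finset.filter_congr fun a _ => and_iff_right_of_imp ?_
    rintro rfl
    exact Finset.mem_Iic.1 hw
  intro v
  have inversion (k : α → β) := IncidenceAlgebra.moebius_inversion_bot (𝕜 := ℤ)
    _ _ (card_le_eq_sum k) v
  have hf := inversion f
  simp only [h] at hf
  exact_mod_cast hf.trans (inversion g).symm

namespace Equidistributed

variable {α β : Type*} [DecidableEq β] {S : Finset α} {f g : α → β}

theorem iff_map_eq : Equidistributed S f g ↔ S.val.map f = S.val.map g := by
  simp only [Equidistributed, Multiset.ext, Multiset.count_map, Finset.card_def, Finset.filter_val,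
    eq_comm]

theorem comp {γ : Type*} [DecidableEq γ] (h : Equidistributed S f g) (k : β → γ) :
    Equidistributed S (fun x => k (f x)) (fun x => k (g x)) := by
  have hmap := congrArg (Multiset.map k) (iff_map_eq.1 h)
  exact iff_map_eq.2 (by simpa only [Multiset.map_map, Function.comp_def] using hmap)

theorem sum_comp_eq {M : Type*} [AddCommMonoid M] (h : Equidistributed S f g) (k : β → M) :
    ∑ x ∈ S, k (f x) = ∑ x ∈ S, k (g x) := by
  have hsum := congrArg (fun m => (m.map k).sum) (iff_map_eq.1 h)
  rw [Multiset.map_map, Multiset.map_map] at hsum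
  exact hsum

theorem congr {f' g' : α → β} (h : Equidistributed S f g) (hf : ∀ x ∈ S, f x = f' x)
    (hg : ∀ x ∈ S, g x = g' x) : Equidistributed S f' g' := by
  rw [iff_map_eq] at h ⊢
  rwa [← Multiset.map_congr rfl hf, ← Multiset.map_congr rfl hg]

end Equidistributed

/-- The identity of `ℤ` for `ε = 1` and the absolute value for `ε = -1`. -/
def twist (ε : ℤˣ) (a : ℤ) : ℤ := if 0 ≤ a then a else ε * a

/-- The sort key by which both orders on `ℤ` compare: first the signs, then the integers themselves
(`ε = 1`, the natural order) or their absolute values (`ε = -1`, the `r`-order). -/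
def key (ε : ℤˣ) (a : ℤ) : ℤ ×ₗ ℤ := toLex (a.sign, twist ε a)

theorem twist_of_nonneg (ε : ℤˣ) {a : ℤ} (ha : 0 ≤ a) : twist ε a = a := if_pos ha

theorem twist_one (a : ℤ) : twist 1 a = a := by simp [twist]

theorem twist_neg_one (a : ℤ) : twist (-1) a = a.natAbs := by
  grind [twist, Units.val_neg, Units.val_one]

theorem key_lt_key_iff {ε : ℤˣ} {a b : ℤ} :
    key ε a < key ε b ↔ a.sign < b.sign ∨ a.sign = b.sign ∧ twist ε a < twist ε b :=
  Prod.Lex.toLex_lt_toLex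

theorem key_le_key_iff {ε : ℤˣ} {a b : ℤ} :
    key ε a ≤ key ε b ↔ a.sign < b.sign ∨ a.sign = b.sign ∧ twist ε a ≤ twist ε b :=
  Prod.Lex.toLex_le_toLex

theorem key_one_lt_key_one_iff {a b : ℤ} : key 1 a < key 1 b ↔ a < b := by
  rw [key_lt_key_iff, twist_one, twist_one]
  grind

theorem key_neg_one_lt_key_neg_one_iff {a b : ℤ} : key (-1) a < key (-1) b ↔ rLT a b := by
  rw [key_lt_key_iff, twist_neg_one, twist_neg_one]
  grind [rLT]

theorem key_injective (ε : ℤˣ) : Function.Injective (key ε) := by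
  intro a b hab
  obtain ⟨hsign, htwist⟩ : a.sign = b.sign ∧ twist ε a = twist ε b :=
    Prod.ext_iff.1 (toLex.injective hab)
  rcases Int.units_eq_one_or ε with rfl | rfl <;> grind [twist_one, twist_neg_one]

theorem key_le_key_iff_of_nonneg {ε : ℤˣ} {a b : ℤ} (ha : 0 ≤ a) (hb : 0 ≤ b) :
    key ε a ≤ key ε b ↔ a ≤ b := by
  rw [key_le_key_iff, twist_of_nonneg ε ha, twist_of_nonneg ε hb]
  grind

theorem key_zero_le_iff {ε : ℤˣ} {a : ℤ} : key ε 0 ≤ key ε a ↔ 0 ≤ a := by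
  rw [key_le_key_iff]
  grind [twist_of_nonneg]

theorem key_neg_one_neg_le_neg_iff {a b : ℤ} (ha : 0 < a) (hb : 0 < b) :
    key (-1) (-a) ≤ key (-1) (-b) ↔ a ≤ b := by
  rw [key_le_key_iff, twist_neg_one, twist_neg_one]
  grind

/-- A symmetric function with `weight ε (x + 1) y - weight ε x y = key ε y` for `x > 0`, so that
a larger total weight is a step towards being sorted. -/
def weight (ε : ℤˣ) (x y : ℤ) : ℤ ×ₗ ℤ :=
  toLex (x * y.sign + x.sign * y, twist ε x * twist ε y)

theorem weight_comm (ε : ℤˣ) (x y : ℤ) : weight ε x y = weight ε y x := by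
  simp only [weight, mul_comm, add_comm]

theorem weight_neg_neg (ε : ℤˣ) (x y : ℤ) : weight ε (-x) (-y) = weight ε x y := by
  rcases Int.units_eq_one_or ε with rfl | rfl <;>
    simp only [weight, twist_one, twist_neg_one, Int.sign_neg, Int.natAbs_neg, neg_mul_neg]

theorem weight_add_one_sub_weight (ε : ℤˣ) {x : ℤ} (hx : 0 < x) (y : ℤ) :
    weight ε (x + 1) y - weight ε x y = key ε y := by
  have hx' : 0 < x + 1 := hx.trans (lt_add_one x)
  simp only [weight, key, Int.sign_eq_one_of_pos hx, Int.sign_eq_one_of_pos hx',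
    twist_of_nonneg ε hx.le, twist_of_nonneg ε hx'.le, ← toLex_sub, Prod.mk_sub_mk]
  ring_nf

section Blocks

variable {n : ℕ} (S : Finset (Fin n))

/-- A set `S` of allowed descents cuts the positions `0, 1, …, n` into intervals, a cut at `i ∈ S`
separating `i` from `i + 1`; `blockIndex S m` numbers the interval of `m`, starting from `0`. -/
def blockIndex (m : ℕ) : ℕ := (S.filter (·.val < m)).card

/-- The odd extension of `blockIndex`, shifted by `1` on the positive integers in order to keep the
sign of `a` visible. -/
def block (a : ℤ) : ℤ := a.sign * (blockIndex S a.natAbs + 1)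

theorem blockIndex_mono : Monotone (blockIndex S) := fun _ _ h =>
  Finset.card_le_card (Finset.monotone_filter_right S fun _ _ hi => hi.trans_le h)

theorem blockIndex_zero : blockIndex S 0 = 0 := by simp [blockIndex]

theorem blockIndex_succ_eq_iff {i : Fin n} :
    blockIndex S (i + 1) = blockIndex S i ↔ i ∉ S := by
  have hsub : S.filter (·.val < i.val) ⊆ S.filter (·.val < i.val + 1) :=
    Finset.monotone_filter_right S fun _ _ => Nat.lt_add_one_of_lt
  rw [blockIndex, blockIndex, eq_comm, ← (Finset.card_le_card hsub).ge_iff_eq,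
    Finset.eq_iff_card_le_of_subset hsub, Finset.ext_iff]
  simp only [Finset.mem_filter]
  refine ⟨fun h hi => by simpa [hi] using h i, fun hi j => and_congr_right fun hj => ?_⟩
  have hne : (j : ℕ) ≠ i := fun h => hi (Fin.ext h ▸ hj)
  omega

theorem block_neg (a : ℤ) : block S (-a) = -block S a := by
  simp only [block, Int.sign_neg, Int.natAbs_neg, neg_mul]

theorem block_of_pos {a : ℤ} (ha : 0 < a) : block S a = blockIndex S a.natAbs + 1 := by
  rw [block, Int.sign_eq_one_of_pos ha, one_mul]

theorem block_add_one {S : Finset (Fin n)} {i : Fin n} (hi : i ∉ S) :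
    block S (i + 1) = blockIndex S i + 1 := by
  rw [block_of_pos S (by omega), ← (blockIndex_succ_eq_iff S).2 hi]
  rfl

theorem sign_block (a : ℤ) : (block S a).sign = a.sign := by
  have hpos : (0 : ℤ) < blockIndex S a.natAbs + 1 := by positivity
  rw [block, Int.sign_mul, Int.sign_sign, Int.sign_eq_one_of_pos hpos, mul_one]

theorem key_block_le_key_block {ε : ℤˣ} {a b : ℤ} (h : key ε a ≤ key ε b) :
    key ε (block S a) ≤ key ε (block S b) := by
  rw [key_le_key_iff] at h ⊢
  rw [sign_block, sign_block]
  refine h.imp_right fun ⟨hsign, htwist⟩ => ⟨hsign, ?_⟩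
  have hab := @blockIndex_mono n S a.natAbs b.natAbs
  have hba := @blockIndex_mono n S b.natAbs a.natAbs
  rcases Int.units_eq_one_or ε with rfl | rfl
  · simp only [twist_one] at htwist ⊢
    grind [block]
  · simp only [twist_neg_one, block, hsign, Int.natAbs_mul] at htwist ⊢
    grind

end Blocks

namespace Omega

variable {n : ℕ}

instance instInvolutiveNeg (n : ℕ) : InvolutiveNeg (Omega n) where
  neg_neg a := Subtype.ext (neg_neg a.1)

theorem coe_neg (a : Omega n) : (-a).1 = -a.1 := rfl

theorem coe_ofFin (p : Fin (n + 1)) : (ofFin p).1 = (p : ℕ) := rfl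

theorem exists_ofFin_eq {a : Omega n} (ha : 0 ≤ a.1) : ∃ p, ofFin p = a :=
  ⟨⟨a.1.natAbs, by have := a.2; omega⟩, Subtype.ext (by rw [coe_ofFin]; simp only; omega)⟩

theorem odd_ext {f g : Omega n → ℤ} (hf : ∀ a, f (-a) = -f a) (hg : ∀ a, g (-a) = -g a)
    (hfg : ∀ a, 0 < a.1 → f a = g a) : f = g := by
  funext a
  rcases lt_trichotomy a.1 0 with ha | ha | ha
  · have hneg := hfg (-a) (by rw [coe_neg]; omega)
    rw [hf, hg] at hneg
    exact neg_injective hneg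
  · have ha' : -a = a := Subtype.ext (by rw [coe_neg]; omega)
    have hfa := hf a
    have hga := hg a
    rw [ha'] at hfa hga
    omega
  · exact hfg a ha

end Omega

namespace SignedPerm

variable {n : ℕ} {ε : ℤˣ} {S T : Finset (Fin n)} {π σ u : SignedPerm n}

theorem apply_neg (π : SignedPerm n) (a : Omega n) : π.1 (-a) = -π.1 a := π.2 a

theorem coe_apply_eq_zero_iff (π : SignedPerm n) {a : Omega n} : (π.1 a).1 = 0 ↔ a.1 = 0 := by
  have eq_zero_iff (b : Omega n) : b.1 = 0 ↔ -b = b := by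
    rw [Subtype.ext_iff, Omega.coe_neg]
    omega
  rw [eq_zero_iff, eq_zero_iff, ← apply_neg, π.1.injective.eq_iff]

theorem entry_zero (π : SignedPerm n) : π.entry 0 = 0 :=
  (coe_apply_eq_zero_iff π).2 (by simp [Omega.coe_ofFin])

/-- The descent set with respect to the order with sort key `key ε`. -/
def Des (ε : ℤˣ) (π : SignedPerm n) : Finset (Fin n) :=
  Finset.univ.filter fun i => key ε (π.entry i.succ) < key ε (π.entry i.castSucc)

theorem mem_Des {i : Fin n} :
    i ∈ Des ε π ↔ key ε (π.entry i.succ) < key ε (π.entry i.castSucc) := by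
  simp only [Des, Finset.mem_filter_univ]

theorem Des_one (π : SignedPerm n) : Des 1 π = π.DesNat := by
  simp only [Des, DesNat, key_one_lt_key_one_iff, gt_iff_lt]

theorem Des_neg_one (π : SignedPerm n) : Des (-1) π = π.DesR := by
  simp only [Des, DesR, key_neg_one_lt_key_neg_one_iff]

theorem monotoneOn_key_entry (h : Des ε π ⊆ S) (k : ℕ) :
    MonotoneOn (fun p => key ε (π.entry p)) {p | blockIndex S p = k} := by
  have hord : Set.OrdConnected {p : Fin (n + 1) | blockIndex S p = k} :=
    Set.ordConnected_singleton.preimage_mono fun _ _ hpq => blockIndex_mono S hpq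
  refine monotoneOn_of_le_succ hord fun p hmax hp hsucc => ?_
  have hlast : p ≠ Fin.last n := fun hlast => hmax fun q _ => hlast ▸ Fin.le_last q
  obtain ⟨i, rfl⟩ := Fin.exists_castSucc_eq.2 hlast
  rw [Fin.orderSucc_castSucc] at hsucc ⊢
  have hi : i ∉ Des ε π := mt (@h i) ((blockIndex_succ_eq_iff S).1 (hsucc.trans hp.symm))
  exact not_lt.1 (mt mem_Des.2 hi)

theorem monotoneOn_key_apply (h : Des ε π ⊆ S) {k : ℤ} (hk : 0 < k) :
    MonotoneOn (fun a : Omega n => key ε (π.1 a).1) {a | block S a.1 = k} := by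
  have pos {a : Omega n} (ha : block S a.1 = k) : 0 < a.1 := by
    rw [← Int.sign_eq_one_iff_pos, ← sign_block S, ha, Int.sign_eq_one_of_pos hk]
  intro a ha b hb hab
  have blockIndex_eq {p : Fin (n + 1)} (hp : block S (Omega.ofFin p).1 = k) :
      blockIndex S p = (k - 1).toNat := by
    rw [block_of_pos S (pos hp), Omega.coe_ofFin, Int.natAbs_natCast] at hp
    omega
  obtain ⟨p, rfl⟩ := Omega.exists_ofFin_eq (pos ha).le
  obtain ⟨q, rfl⟩ := Omega.exists_ofFin_eq (pos hb).le
  exact monotoneOn_key_entry h (k - 1).toNat (blockIndex_eq ha) (blockIndex_eq hb)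
    (Int.ofNat_le.1 hab)

theorem apply_pos_of_block_eq_one (h : Des ε π ⊆ S) {a : Omega n} (ha : block S a.1 = 1) :
    0 < (π.1 a).1 := by
  have hpos : 0 < a.1 := by rw [← Int.sign_eq_one_iff_pos, ← sign_block S, ha, Int.sign_one]
  obtain ⟨p, rfl⟩ := Omega.exists_ofFin_eq hpos.le
  rw [block_of_pos S hpos, Omega.coe_ofFin, Int.natAbs_natCast] at ha
  have hkey : key ε (π.entry 0) ≤ key ε (π.entry p) := monotoneOn_key_entry h 0
    (blockIndex_zero S) (by simpa using ha) (Fin.zero_le p)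
  rw [entry_zero] at hkey
  exact (key_zero_le_iff.1 hkey).lt_of_ne' (mt (coe_apply_eq_zero_iff π).1 hpos.ne')

/-- The Young subgroup of the signed permutations that map every block of positions to itself,
and hence preserve signs. -/
def youngSubgroup (S : Finset (Fin n)) : Subgroup (SignedPerm n) where
  carrier := {u | ∀ a, block S (u.1 a).1 = block S a.1}
  mul_mem' hu hv a := (hu _).trans (hv a)
  one_mem' _ := rfl
  inv_mem' {u} hu a := by simpa using (hu (u⁻¹.1 a)).symm

theorem sign_apply_of_mem_youngSubgroup (hu : u ∈ youngSubgroup S) (a : Omega n) :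
    (u.1 a).1.sign = a.1.sign := by
  rw [← sign_block S, hu, sign_block]

/-- The double coset of `π` by the Young subgroups of `T` (on values) and of `S` (on positions). -/
abbrev youngDoubleCoset (S T : Finset (Fin n)) (π : SignedPerm n) : Set (SignedPerm n) :=
  DoubleCoset.doubleCoset π (youngSubgroup T) (youngSubgroup S)

theorem inv_mem_youngDoubleCoset (h : σ ∈ youngDoubleCoset S T π) :
    σ⁻¹ ∈ youngDoubleCoset T S π⁻¹ := by
  obtain ⟨t, ht, u, hu, rfl⟩ := DoubleCoset.mem_doubleCoset.1 h
  exact DoubleCoset.mem_doubleCoset.2 ⟨u⁻¹, inv_mem hu, t⁻¹, inv_mem ht, by group⟩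

theorem mul_mem_youngDoubleCoset (h : σ ∈ youngDoubleCoset S T π) (hu : u ∈ youngSubgroup S) :
    σ * u ∈ youngDoubleCoset S T π := by
  obtain ⟨t, ht, v, hv, rfl⟩ := DoubleCoset.mem_doubleCoset.1 h
  exact DoubleCoset.mem_doubleCoset.2 ⟨t, ht, v * u, mul_mem hv hu, by group⟩

/-- `π` is sorted for the order with sort key `key ε` within each block of positions defined by
`S`, and so is `π⁻¹` for `T`. -/
structure IsSorted (ε : ℤˣ) (S T : Finset (Fin n)) (π : SignedPerm n) : Prop where
  Des_subset : Des ε π ⊆ S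
  Des_inv_subset : Des ε π⁻¹ ⊆ T

theorem IsSorted.inv (h : IsSorted ε S T π) : IsSorted ε T S π⁻¹ :=
  ⟨h.Des_inv_subset, (inv_inv π).symm ▸ h.Des_subset⟩

theorem eq_of_Des_subset_of_rearrangement {f : ℤ → ℤ} (hodd : ∀ a, f (-a) = -f a)
    (hmono : ∀ a b, key ε a ≤ key ε b → key ε (f a) ≤ key ε (f b)) (hπ : Des ε π ⊆ S)
    (hσ : Des ε σ ⊆ S) (hu : u ∈ youngSubgroup S) (h : ∀ a, f (σ.1 a).1 = f (π.1 (u.1 a)).1) :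
    ∀ a, f (σ.1 a).1 = f (π.1 a).1 := by
  have odd_comp (ρ : SignedPerm n) (a : Omega n) : f (ρ.1 (-a)).1 = -f (ρ.1 a).1 := by
    rw [apply_neg, Omega.coe_neg, hodd]
  refine congrFun (Omega.odd_ext (odd_comp σ) (odd_comp π) fun a ha => key_injective ε ?_)
  have hblock : 0 < block S a.1 := by
    rw [← Int.sign_eq_one_iff_pos, sign_block, Int.sign_eq_one_of_pos ha]
  have sorted {ρ : SignedPerm n} (hρ : Des ε ρ ⊆ S) :
      MonotoneOn (fun b => key ε (f (ρ.1 b).1)) {b : Omega n | block S b.1 = block S a.1} :=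
    fun _ hb _ hc hbc => hmono _ _ (monotoneOn_key_apply hρ hblock hb hc hbc)
  have hkey : (fun b => key ε (f (σ.1 b).1)) = (fun b => key ε (f (π.1 b).1)) ∘ u.1 :=
    funext fun b => congrArg (key ε) (h b)
  have hblocks (b : Omega n) : block S (u.1 b).1 = block S a.1 ↔ block S b.1 = block S a.1 := by
    rw [hu b]
  exact (congrFun hkey a).trans
    (eqOn_of_monotoneOn_comp_perm hblocks (sorted hπ) (hkey ▸ sorted hσ) rfl)

theorem IsSorted.eq_of_mem_youngDoubleCoset (hπ : IsSorted ε S T π) (hσ : IsSorted ε S T σ)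
    (h : σ ∈ youngDoubleCoset S T π) : σ = π := by
  obtain ⟨t, ht, u, hu, rfl⟩ := DoubleCoset.mem_doubleCoset.1 h
  have hblocks := eq_of_Des_subset_of_rearrangement (block_neg S)
    (fun _ _ => key_block_le_key_block S) hπ.Des_inv_subset hσ.Des_inv_subset (inv_mem ht)
    fun a => by simpa using inv_mem hu (π⁻¹.1 (t⁻¹.1 a))
  have hmem : π⁻¹ * (t * π * u) ∈ youngSubgroup S := fun a => by
    simpa using (hblocks ((t * π * u).1 a)).symm
  have hvalues := eq_of_Des_subset_of_rearrangement (f := id) (fun _ => rfl)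
    (fun _ _ => id) hπ.Des_subset hσ.Des_subset hmem fun a => by simp
  exact Subtype.ext (Equiv.ext fun a => Subtype.ext (hvalues a))

/-- The signed permutation exchanging `v` and `w`, hence also `-v` and `-w`. -/
def signedSwap {v w : Omega n} (hv : 0 < v.1) (hvw : v.1 < w.1) : SignedPerm n :=
  ⟨Equiv.swap v w * Equiv.swap (-v) (-w), fun a => by
    have hdisjoint : [v, w, -v, -w].Nodup := by
      simp only [List.nodup_cons, List.mem_cons, Subtype.ext_iff, Omega.coe_neg]
      simp only [List.not_mem_nil, or_false, not_or, neg_inj, not_false_eq_true, List.nodup_nil,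
        and_self, and_true]
      omega
    have hcomm (b : Omega n) := DFunLike.congr_fun
      (Equiv.Perm.disjoint_swap_swap hdisjoint).commute.eq b
    have swap_neg (b c d : Omega n) : Equiv.swap b c (-d) = -Equiv.swap (-b) (-c) d := by
      simpa using (neg_injective.map_swap (-b) (-c) d).symm
    calc Equiv.swap v w (Equiv.swap (-v) (-w) (-a)) = -Equiv.swap (-v) (-w) (Equiv.swap v w a) := by
          rw [swap_neg, swap_neg, neg_neg, neg_neg]
      _ = -Equiv.swap v w (Equiv.swap (-v) (-w) a) := congrArg Neg.neg (hcomm a).symm⟩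

theorem signedSwap_mem_youngSubgroup {v w : Omega n} (hv : 0 < v.1) (hvw : v.1 < w.1)
    (h : block S v.1 = block S w.1) : signedSwap hv hvw ∈ youngSubgroup S := fun a => by
  have hneg : block S (-v).1 = block S (-w).1 := by
    rw [Omega.coe_neg, Omega.coe_neg, block_neg, block_neg, h]
  let blockOf (b : Omega n) : ℤ := block S b.1
  exact (Equiv.apply_swap_eq_self (v := blockOf) h _).trans
    (Equiv.apply_swap_eq_self (v := blockOf) hneg a)

/-- The potential that increases whenever a descent of `π` or of `π⁻¹` is removed by exchanging
the two entries. -/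
def totalWeight (ε : ℤˣ) (π : SignedPerm n) : ℤ ×ₗ ℤ := ∑ a : Omega n, weight ε a.1 (π.1 a).1

theorem totalWeight_inv (ε : ℤˣ) (π : SignedPerm n) : totalWeight ε π⁻¹ = totalWeight ε π := by
  rw [totalWeight, ← Equiv.sum_comp π.1]
  refine Finset.sum_congr rfl fun a _ => ?_
  rw [weight_comm]
  simp

theorem totalWeight_mul_signedSwap_sub (ε : ℤˣ) (π : SignedPerm n) {v w : Omega n}
    (hv : 0 < v.1) (hw : w.1 = v.1 + 1) :
    totalWeight ε (π * signedSwap hv ((lt_add_one _).trans_eq hw.symm)) - totalWeight ε π =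
      2 • (key ε (π.1 v).1 - key ε (π.1 w).1) := by
  have hvw : v.1 < w.1 := (lt_add_one _).trans_eq hw.symm
  let ρ := π.1 * Equiv.swap v w
  have apply_neg_eq {x : Omega n} (hx : 0 < x.1) : (ρ (-x)).1 = -(π.1 x).1 := by
    rw [← Omega.coe_neg, ← apply_neg]
    refine congrArg (fun y => (π.1 y).1) (Equiv.swap_apply_of_ne_of_ne ?_ ?_) <;>
    · rw [Ne, Subtype.ext_iff, Omega.coe_neg]
      omega
  have hpos := sum_apply_mul_swap (fun a b : Omega n => weight ε a.1 b.1) π.1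
    (fun h => hvw.ne (congrArg Subtype.val h) : v ≠ w)
  have hneg := sum_apply_mul_swap (fun a b : Omega n => weight ε a.1 b.1) ρ
    (fun h => hvw.ne (congrArg Subtype.val (neg_injective h)) : -v ≠ -w)
  simp only [apply_neg_eq hv, apply_neg_eq (hv.trans hvw), Omega.coe_neg, weight_neg_neg] at hneg
  have hswap : (π * signedSwap hv hvw).1 = ρ * Equiv.swap (-v) (-w) := (mul_assoc _ _ _).symm
  rw [totalWeight, totalWeight, hswap, ← sub_add_sub_cancel, hneg, hpos, two_nsmul, hw,
    ← weight_add_one_sub_weight ε hv (π.1 v).1, ← weight_add_one_sub_weight ε hv (π.1 w).1]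
  abel

theorem Des_subset_of_totalWeight_le (hfirst : ∀ a, block S a.1 = 1 → 0 < (π.1 a).1)
    (hmax : ∀ u ∈ youngSubgroup S, totalWeight ε (π * u) ≤ totalWeight ε π) : Des ε π ⊆ S := by
  intro i hi
  by_contra hiS
  rw [mem_Des] at hi
  rcases Nat.eq_zero_or_pos i with h0 | h0
  · have hzero : i.castSucc = 0 := Fin.ext h0
    have hpos : 0 < π.entry i.succ := hfirst _ (by
      simpa [Omega.coe_ofFin, h0, blockIndex_zero] using block_add_one hiS)
    rw [hzero, entry_zero] at hi
    exact hi.not_ge (key_zero_le_iff.2 hpos.le)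
  · have hv : 0 < (Omega.ofFin i.castSucc).1 := Int.natCast_pos.2 h0
    have hvw : (Omega.ofFin i.castSucc).1 < (Omega.ofFin i.succ).1 :=
      Int.ofNat_lt.2 (Nat.lt_succ_self i)
    have hblock : block S (Omega.ofFin i.castSucc).1 = block S (Omega.ofFin i.succ).1 :=
      (block_of_pos S hv).trans (block_add_one hiS).symm
    have hle := hmax _ (signedSwap_mem_youngSubgroup hv hvw hblock)
    rw [← sub_nonpos, totalWeight_mul_signedSwap_sub ε π hv rfl] at hle
    exact hle.not_gt (nsmul_pos (sub_pos.2 hi) two_ne_zero)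

theorem IsSorted.apply_pos (h : IsSorted ε S T π) (hσ : σ ∈ youngDoubleCoset S T π)
    {a : Omega n} (ha : block S a.1 = 1) : 0 < (σ.1 a).1 := by
  obtain ⟨t, ht, u, hu, rfl⟩ := DoubleCoset.mem_doubleCoset.1 hσ
  have hpos := apply_pos_of_block_eq_one h.Des_subset ((hu a).trans ha)
  rw [← Int.sign_eq_one_iff_pos] at hpos ⊢
  exact (sign_apply_of_mem_youngSubgroup ht _).trans hpos

theorem IsSorted.exists_mem_youngDoubleCoset (h : IsSorted ε S T π) (ε' : ℤˣ) :
    ∃ σ ∈ youngDoubleCoset S T π, IsSorted ε' S T σ := by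
  obtain ⟨σ, hσ, hmax⟩ := Set.exists_max_image (youngDoubleCoset S T π) (totalWeight ε')
    (Set.toFinite _) ⟨π, DoubleCoset.mem_doubleCoset_self _ _ π⟩
  have hσ_inv := inv_mem_youngDoubleCoset hσ
  refine ⟨σ, hσ, Des_subset_of_totalWeight_le (fun _ => h.apply_pos hσ) fun u hu => ?_,
    Des_subset_of_totalWeight_le (fun _ => h.inv.apply_pos hσ_inv) fun u hu => ?_⟩
  · exact hmax _ (mul_mem_youngDoubleCoset hσ hu)
  · rw [← totalWeight_inv, totalWeight_inv ε' σ]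
    have hmem := inv_mem_youngDoubleCoset (mul_mem_youngDoubleCoset hσ_inv hu)
    rw [inv_inv π] at hmem
    exact hmax _ hmem

instance decidablePredIsSorted (ε : ℤˣ) (S T : Finset (Fin n)) : DecidablePred (IsSorted ε S T) :=
  fun π => decidable_of_iff (Des ε π ⊆ S ∧ Des ε π⁻¹ ⊆ T) ⟨fun h => ⟨h.1, h.2⟩, fun h => ⟨h.1, h.2⟩⟩

theorem card_filter_isSorted_le {I : Finset (SignedPerm n)} {ε ε' : ℤˣ}
    (hI : ∀ π ∈ I, IsSorted ε S T π → ∀ σ ∈ youngDoubleCoset S T π, IsSorted ε' S T σ → σ ∈ I) :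
    (I.filter (IsSorted ε S T)).card ≤ (I.filter (IsSorted ε' S T)).card := by
  refine Finset.card_le_card_of_forall_subsingleton (fun π σ => σ ∈ youngDoubleCoset S T π)
    (fun π hπ => ?_) fun σ _ π ⟨hπ, hσπ⟩ ρ ⟨hρ, hσρ⟩ => ?_
  · obtain ⟨hπI, hπ⟩ := Finset.mem_filter.1 hπ
    obtain ⟨σ, hσ, hsorted⟩ := hπ.exists_mem_youngDoubleCoset ε'
    exact ⟨σ, Finset.mem_filter.2 ⟨hI π hπI hπ σ hσ hsorted, hsorted⟩, hσ⟩
  · refine IsSorted.eq_of_mem_youngDoubleCoset (Finset.mem_filter.1 hρ).2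
      (Finset.mem_filter.1 hπ).2 ?_
    rw [youngDoubleCoset, ← DoubleCoset.doubleCoset_eq_of_mem hσρ,
      DoubleCoset.doubleCoset_eq_of_mem hσπ]
    exact DoubleCoset.mem_doubleCoset_self _ _ π

theorem equidistributed_Des_prod_Des_inv (n : ℕ) (ε ε' : ℤˣ) :
    Equidistributed (Finset.univ : Finset (SignedPerm n))
      (fun π => (Des ε π, Des ε π⁻¹)) (fun π => (Des ε' π, Des ε' π⁻¹)) := by
  refine equidistributed_of_card_filter_le_eq fun ⟨S, T⟩ => ?_
  have filter_eq (ε : ℤˣ) : (Finset.univ.filter fun π : SignedPerm n =>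
      (Des ε π, Des ε π⁻¹) ≤ (S, T)) = Finset.univ.filter (IsSorted ε S T) :=
    Finset.filter_congr fun π _ => ⟨fun h => ⟨h.1, h.2⟩, fun h => ⟨h.1, h.2⟩⟩
  rw [filter_eq, filter_eq]
  exact (card_filter_isSorted_le fun _ _ _ σ _ _ => Finset.mem_univ σ).antisymm
    (card_filter_isSorted_le fun _ _ _ σ _ _ => Finset.mem_univ σ)

theorem mem_signedInvolutions : π ∈ signedInvolutions n ↔ π⁻¹ = π :=
  Finset.mem_filter_univ π

theorem IsSorted.inv_eq_self_of_mem_youngDoubleCoset (hσ : IsSorted ε S S σ) (hπ : π⁻¹ = π)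
    (h : σ ∈ youngDoubleCoset S S π) : σ⁻¹ = σ := by
  have hinv := inv_mem_youngDoubleCoset h
  rw [hπ, youngDoubleCoset, ← DoubleCoset.doubleCoset_eq_of_mem h] at hinv
  exact hσ.eq_of_mem_youngDoubleCoset hσ.inv hinv

theorem card_filter_Des_subset_le {I : Finset (SignedPerm n)} {ε ε' : ℤˣ}
    (hI : I ⊆ signedInvolutions n) (hmem : ∀ π ∈ I, Des ε π ⊆ S →
      ∀ σ ∈ signedInvolutions n, σ ∈ youngDoubleCoset S S π → σ ∈ I) :
    (I.filter (Des ε · ⊆ S)).card ≤ (I.filter (Des ε' · ⊆ S)).card := by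
  have filter_eq (ε : ℤˣ) : I.filter (Des ε · ⊆ S) = I.filter (IsSorted ε S S) :=
    Finset.filter_congr fun π hπ =>
      ⟨fun h => ⟨h, by rwa [mem_signedInvolutions.1 (hI hπ)]⟩, IsSorted.Des_subset⟩
  rw [filter_eq, filter_eq]
  refine card_filter_isSorted_le fun π hπ hsorted σ hσ hσ_sorted =>
    hmem π hπ hsorted.Des_subset σ ?_ hσ
  exact mem_signedInvolutions.2 <|
    hσ_sorted.inv_eq_self_of_mem_youngDoubleCoset (mem_signedInvolutions.1 (hI hπ)) hσ

theorem equidistributed_Des_signedInvolutions (n : ℕ) (ε ε' : ℤˣ) :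
    Equidistributed (signedInvolutions n) (Des ε) (Des ε') :=
  equidistributed_of_card_filter_le_eq fun _ =>
    (card_filter_Des_subset_le subset_rfl fun _ _ _ _ hσ _ => hσ).antisymm
      (card_filter_Des_subset_le subset_rfl fun _ _ _ _ hσ _ => hσ)

theorem desNat_eq_card_Des (π : SignedPerm n) : π.desNat = (Des 1 π).card := by
  rw [Des_one, desNat]

theorem desR_eq_card_Des (π : SignedPerm n) : π.desR = (Des (-1) π).card := by
  rw [Des_neg_one, desR]

theorem idesNat_eq_desNat_inv (π : SignedPerm n) : π.idesNat = desNat π⁻¹ := rfl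

theorem idesR_eq_desR_inv (π : SignedPerm n) : π.idesR = desR π⁻¹ := rfl

theorem equidistributed_des_prod_ides (n : ℕ) :
    Equidistributed (Finset.univ : Finset (SignedPerm n))
      (fun π => (π.desNat, π.idesNat)) (fun π => (π.desR, π.idesR)) := by
  simpa only [idesNat_eq_desNat_inv, idesR_eq_desR_inv, desNat_eq_card_Des, desR_eq_card_Des] using
    (equidistributed_Des_prod_Des_inv n 1 (-1)).comp fun D => (D.1.card, D.2.card)

theorem equidistributed_des_signedInvolutions (n : ℕ) :
    Equidistributed (signedInvolutions n) (fun π => π.desNat) (fun π => π.desR) := by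
  simpa only [desNat_eq_card_Des, desR_eq_card_Des] using
    (equidistributed_Des_signedInvolutions n 1 (-1)).comp Finset.card

theorem equidistributed_des_prod_ides_signedInvolutions (n : ℕ) :
    Equidistributed (signedInvolutions n)
      (fun π => (π.desNat, π.idesNat)) (fun π => (π.desR, π.idesR)) :=
  ((equidistributed_des_signedInvolutions n).comp fun d => (d, d)).congr
    (fun π hπ => by rw [idesNat_eq_desNat_inv, mem_signedInvolutions.1 hπ])
    (fun π hπ => by rw [idesR_eq_desR_inv, mem_signedInvolutions.1 hπ])

theorem apply_apply_of_inv_eq_self (hπ : π⁻¹ = π) (a : Omega n) : π.1 (π.1 a) = a := by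
  nth_rw 1 [← hπ]
  exact π.1.symm_apply_apply a

theorem mem_fixedPointFreeSignedInvolutions : π ∈ fixedPointFreeSignedInvolutions n ↔
    π⁻¹ = π ∧ ∀ a : Omega n, 0 < a.1 → π.1 a ≠ a ∧ π.1 a ≠ -a := by
  rw [fixedPointFreeSignedInvolutions, Finset.mem_filter, mem_signedInvolutions]
  refine and_congr_right fun _ => ⟨fun h a ha => ?_, fun h i => ?_⟩
  · obtain ⟨p, rfl⟩ := Omega.exists_ofFin_eq ha.le
    obtain ⟨i, rfl⟩ := Fin.exists_succ_eq.2 (show p ≠ 0 by rintro rfl; exact ha.ne rfl)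
    exact ⟨mt (Subtype.ext_iff.1) (h i).1, mt (Subtype.ext_iff.1) (h i).2⟩
  · obtain ⟨hfix, hneg⟩ := h (Omega.ofFin i.succ) (Int.natCast_pos.2 i.succ_pos)
    exact ⟨fun heq => hfix (Subtype.ext heq), fun heq => hneg (Subtype.ext heq)⟩

theorem exists_apply_eq_or_eq_neg_of_odd (hn : Odd n) (hπ : π⁻¹ = π) :
    ∃ a : Omega n, 0 < a.1 ∧ (π.1 a = a ∨ π.1 a = -a) := by
  have entry_ne_zero (i : Fin n) : π.entry i.succ ≠ 0 :=
    mt (coe_apply_eq_zero_iff π).1 (Int.natCast_pos.2 i.succ_pos).ne'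
  let f (i : Fin n) : Fin n := ⟨(π.entry i.succ).natAbs - 1, by
    have hle := (π.1 (Omega.ofFin i.succ)).2
    have hne := entry_ne_zero i
    rw [entry] at hne ⊢
    omega⟩
  have ofFin_succ_f (i : Fin n) : Omega.ofFin (f i).succ = π.1 (Omega.ofFin i.succ) ∨
      Omega.ofFin (f i).succ = -π.1 (Omega.ofFin i.succ) := by
    have hne := entry_ne_zero i
    simp only [Subtype.ext_iff, Omega.coe_neg, Omega.coe_ofFin, Fin.val_succ, f, entry] at hne ⊢
    omega
  have hf : Function.Involutive f := fun i => Fin.ext <| by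
    change (π.1 (Omega.ofFin (f i).succ)).1.natAbs - 1 = i
    have natAbs_apply : (π.1 (Omega.ofFin (f i).succ)).1.natAbs = i + 1 := by
      rcases ofFin_succ_f i with h | h
      · rw [h, apply_apply_of_inv_eq_self hπ, Omega.coe_ofFin, Int.natAbs_natCast, Fin.val_succ]
      · rw [h, apply_neg, apply_apply_of_inv_eq_self hπ, Omega.coe_neg, Int.natAbs_neg,
          Omega.coe_ofFin, Int.natAbs_natCast, Fin.val_succ]
    rw [natAbs_apply, Nat.add_sub_cancel]
  have not_two_dvd : ¬ 2 ∣ Fintype.card (Fin n) := by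
    rwa [Fintype.card_fin, ← even_iff_two_dvd, Nat.not_even_iff_odd]
  have pow_two_pow_one : hf.toPerm ^ 2 ^ 1 = 1 := Equiv.ext fun i => by simp [pow_two, hf i]
  obtain ⟨i, hfix : f i = i⟩ := Equiv.Perm.exists_fixed_point_of_prime not_two_dvd pow_two_pow_one
  refine ⟨Omega.ofFin i.succ, Int.natCast_pos.2 i.succ_pos, ?_⟩
  have h := ofFin_succ_f i
  rw [hfix] at h
  exact h.imp Eq.symm fun h => neg_eq_iff_eq_neg.1 h.symm

theorem fixedPointFreeSignedInvolutions_eq_empty (hn : Odd n) :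
    fixedPointFreeSignedInvolutions n = ∅ := by
  refine Finset.eq_empty_of_forall_notMem fun π hπ => ?_
  obtain ⟨hinv, hfree⟩ := mem_fixedPointFreeSignedInvolutions.1 hπ
  obtain ⟨a, ha, hfix⟩ := exists_apply_eq_or_eq_neg_of_odd hn hinv
  exact hfix.elim (hfree a ha).1 (hfree a ha).2

theorem apply_eq_of_block_apply_eq (hinv : π⁻¹ = π) (h : Des ε π ⊆ S) {a : Omega n}
    (ha : 0 < a.1) (hblock : block S (π.1 a).1 = block S a.1) : π.1 a = a := by
  have hmono := monotoneOn_key_apply h (k := block S a.1)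
    (by rwa [← Int.sign_eq_one_iff_pos, sign_block, Int.sign_eq_one_iff_pos])
  have hpos : 0 < (π.1 a).1 := by
    rwa [← Int.sign_eq_one_iff_pos, ← sign_block S, hblock, sign_block, Int.sign_eq_one_iff_pos]
  rcases le_total (π.1 a) a with hle | hle
  · have hkey := hmono hblock rfl hle
    simp only [apply_apply_of_inv_eq_self hinv, key_le_key_iff_of_nonneg ha.le hpos.le] at hkey
    exact hle.antisymm hkey
  · have hkey := hmono rfl hblock hle
    simp only [apply_apply_of_inv_eq_self hinv, key_le_key_iff_of_nonneg hpos.le ha.le] at hkey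
    exact le_antisymm hkey hle

theorem apply_eq_neg_of_block_apply_eq_neg (hinv : π⁻¹ = π) (h : Des (-1) π ⊆ S) {a : Omega n}
    (ha : 0 < a.1) (hblock : block S (π.1 a).1 = -block S a.1) : π.1 a = -a := by
  have hmono := monotoneOn_key_apply h (k := block S a.1)
    (by rwa [← Int.sign_eq_one_iff_pos, sign_block, Int.sign_eq_one_iff_pos])
  obtain ⟨b, hb⟩ : ∃ b, π.1 a = -b := ⟨-π.1 a, (neg_neg _).symm⟩
  have hba : π.1 b = -a := by
    rw [← neg_neg b, ← hb, apply_neg, apply_apply_of_inv_eq_self hinv]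
  have hblock' : block S b.1 = block S a.1 := by
    rwa [hb, Omega.coe_neg, block_neg, neg_inj] at hblock
  have hpos : 0 < b.1 := by
    rwa [← Int.sign_eq_one_iff_pos, ← sign_block S, hblock', sign_block, Int.sign_eq_one_iff_pos]
  rw [hb, neg_inj]
  rcases le_total b a with hle | hle
  · have hkey := hmono hblock' rfl hle
    simp only [hb, hba, Omega.coe_neg, key_neg_one_neg_le_neg_iff ha hpos] at hkey
    exact hle.antisymm hkey
  · have hkey := hmono rfl hblock' hle
    simp only [hb, hba, Omega.coe_neg, key_neg_one_neg_le_neg_iff hpos ha] at hkey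
    exact le_antisymm hkey hle

theorem natAbs_block_apply_ne (hπ : π ∈ fixedPointFreeSignedInvolutions n) (h : Des (-1) π ⊆ S)
    {a : Omega n} (ha : 0 < a.1) : (block S (π.1 a).1).natAbs ≠ (block S a.1).natAbs := by
  obtain ⟨hinv, hfree⟩ := mem_fixedPointFreeSignedInvolutions.1 hπ
  rw [Ne, Int.natAbs_eq_natAbs_iff]
  rintro (hblock | hblock)
  · exact (hfree a ha).1 (apply_eq_of_block_apply_eq hinv h ha hblock)
  · exact (hfree a ha).2 (apply_eq_neg_of_block_apply_eq_neg hinv h ha hblock)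

theorem mem_fixedPointFreeSignedInvolutions_of_mem_youngDoubleCoset
    (hπ : π ∈ fixedPointFreeSignedInvolutions n) (h : Des (-1) π ⊆ S)
    (hσ : σ ∈ signedInvolutions n) (hσπ : σ ∈ youngDoubleCoset S S π) :
    σ ∈ fixedPointFreeSignedInvolutions n := by
  refine mem_fixedPointFreeSignedInvolutions.2 ⟨mem_signedInvolutions.1 hσ, fun a ha => ?_⟩
  obtain ⟨t, ht, u, hu, rfl⟩ := DoubleCoset.mem_doubleCoset.1 hσπ
  have hpos : 0 < (u.1 a).1 := by
    rwa [← Int.sign_eq_one_iff_pos, sign_apply_of_mem_youngSubgroup hu, Int.sign_eq_one_iff_pos]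
  have hne := natAbs_block_apply_ne hπ h hpos
  have hblock : block S ((t * π * u).1 a).1 = block S (π.1 (u.1 a)).1 := ht _
  rw [← hblock, hu a] at hne
  constructor <;> intro heq <;> refine hne ?_
  · rw [heq]
  · rw [heq, Omega.coe_neg, block_neg, Int.natAbs_neg]

theorem Des_nonempty_of_mem_fixedPointFreeSignedInvolutions (hn : 0 < n) (ε : ℤˣ)
    (hπ : π ∈ fixedPointFreeSignedInvolutions n) : (Des ε π).Nonempty := by
  obtain ⟨hinv, hfree⟩ := mem_fixedPointFreeSignedInvolutions.1 hπ
  by_contra hempty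
  have hDes : Des ε π ⊆ ∅ := (Finset.not_nonempty_iff_eq_empty.1 hempty).subset
  have block_eq_one {a : Omega n} (ha : 0 < a.1) :
      block (∅ : Finset (Fin n)) a.1 = 1 := by
    simp [block_of_pos ∅ ha, blockIndex]
  let a : Omega n := ⟨1, by omega, by omega⟩
  have ha : 0 < a.1 := one_pos
  have hpos := apply_pos_of_block_eq_one hDes (block_eq_one ha)
  exact (hfree a ha).1 (apply_eq_of_block_apply_eq hinv hDes ha
    ((block_eq_one hpos).trans (block_eq_one ha).symm))

/-- The signed permutation with entries `-n, …, -2, -1`. -/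
def negShift (n : ℕ) : SignedPerm n :=
  ⟨Function.Involutive.toPerm
    (fun a => ⟨if 0 < a.1 then a.1 - (n + 1) else if a.1 < 0 then a.1 + (n + 1) else 0, by
      have := a.2
      split_ifs <;> omega⟩)
    fun a => Subtype.ext (by
      have := a.2
      dsimp only
      split_ifs <;> omega),
    fun a => Subtype.ext (by
      dsimp only [Function.Involutive.toPerm, Equiv.coe_fn_mk, Omega.coe_neg]
      split_ifs <;> omega)⟩

theorem coe_negShift_apply {a : Omega n} (ha : 0 < a.1) : ((negShift n).1 a).1 = a.1 - (n + 1) :=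
  if_pos ha

theorem negShift_inv (n : ℕ) : (negShift n)⁻¹ = negShift n := rfl

theorem negShift_mem_fixedPointFreeSignedInvolutions (hn : Even n) :
    negShift n ∈ fixedPointFreeSignedInvolutions n := by
  refine mem_fixedPointFreeSignedInvolutions.2 ⟨negShift_inv n, fun a ha => ?_⟩
  obtain ⟨m, rfl⟩ := hn
  rw [Ne, Ne, Subtype.ext_iff, Subtype.ext_iff, coe_negShift_apply ha, Omega.coe_neg]
  omega

theorem Des_one_negShift (hn : 0 < n) : Des 1 (negShift n) = {⟨0, hn⟩} := by
  ext i
  rw [mem_Des, key_one_lt_key_one_iff, Finset.mem_singleton]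
  have hsucc : (negShift n).entry i.succ = i - n := by
    rw [entry, coe_negShift_apply (Int.natCast_pos.2 i.succ_pos), Omega.coe_ofFin, Fin.val_succ]
    omega
  rcases Nat.eq_zero_or_pos i with h0 | h0
  · have hzero : i.castSucc = 0 := Fin.ext h0
    rw [hsucc, hzero, entry_zero]
    exact iff_of_true (by omega) (Fin.ext h0)
  · have hcastSucc : (negShift n).entry i.castSucc = i - (n + 1) :=
      coe_negShift_apply (Int.natCast_pos.2 h0)
    rw [hsucc, hcastSucc]
    exact iff_of_false (by omega) fun hi => h0.ne' (congrArg Fin.val hi)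

theorem Des_neg_one_ne_singleton_zero (hn : 0 < n) (hπ : π ∈ fixedPointFreeSignedInvolutions n) :
    Des (-1) π ≠ {⟨0, hn⟩} := fun h => by
  have natAbs_block {a : Omega n} (ha : a.1 ≠ 0) :
      (block {(⟨0, hn⟩ : Fin n)} a.1).natAbs = 2 := by
    rw [block, blockIndex, Finset.filter_singleton, if_pos (Int.natAbs_pos.2 ha),
      Finset.card_singleton, Int.natAbs_mul, Int.natAbs_sign_of_ne_zero ha]
    rfl
  let a : Omega n := ⟨1, by omega, by omega⟩
  exact natAbs_block_apply_ne hπ h.subset (a := a) one_pos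
    ((natAbs_block (mt (coe_apply_eq_zero_iff π).1 one_ne_zero)).trans
      (natAbs_block one_ne_zero).symm)

theorem card_desR_eq_one_lt_card_desNat_eq_one (hn : 0 < n) (he : Even n) :
    ((fixedPointFreeSignedInvolutions n).filter (·.desR = 1)).card <
      ((fixedPointFreeSignedInvolutions n).filter (·.desNat = 1)).card := by
  have Des_eq_singleton_iff (ε : ℤˣ) (i : Fin n) {π : SignedPerm n}
      (hπ : π ∈ fixedPointFreeSignedInvolutions n) : Des ε π = {i} ↔ Des ε π ⊆ {i} :=
    ((Des_nonempty_of_mem_fixedPointFreeSignedInvolutions hn ε hπ).subset_singleton_iff).symm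
  simp only [desR_eq_card_Des, desNat_eq_card_Des, card_filter_card_eq_one]
  refine Finset.sum_lt_sum (fun i _ => ?_) ⟨⟨0, hn⟩, Finset.mem_univ _, ?_⟩
  · rw [Finset.filter_congr fun _ => Des_eq_singleton_iff (-1) i,
      Finset.filter_congr fun _ => Des_eq_singleton_iff 1 i]
    exact card_filter_Des_subset_le (Finset.filter_subset _ _) fun π hπ h σ hσ =>
      mem_fixedPointFreeSignedInvolutions_of_mem_youngDoubleCoset hπ h hσ
  · rw [Finset.filter_eq_empty_iff.2 fun π hπ => Des_neg_one_ne_singleton_zero hn hπ,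
      Finset.card_empty, Finset.card_pos]
    exact ⟨negShift n, Finset.mem_filter.2
      ⟨negShift_mem_fixedPointFreeSignedInvolutions he, Des_one_negShift hn⟩⟩

theorem not_equidistributed_des_fixedPointFreeSignedInvolutions (hn : 0 < n) (he : Even n) :
    ¬ Equidistributed (fixedPointFreeSignedInvolutions n)
      (fun π => π.desNat) (fun π => π.desR) :=
  fun h => (card_desR_eq_one_lt_card_desNat_eq_one hn he).ne' (h 1)

end SignedPerm

theorem mainTheorem3 (n : ℕ) (hn : 0 < n) :
    -- the pairs are equidistributed over the whole group
    Equidistributed (Finset.univ : Finset (SignedPerm n))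
      (fun π => (π.desNat, π.idesNat)) (fun π => (π.desR, π.idesR)) ∧
    twoSidedEulerianNat n = twoSidedEulerianR n ∧
    -- equidistribution over the signed involutions
    Equidistributed (signedInvolutions n)
      (fun π => π.desNat) (fun π => π.desR) ∧
    Equidistributed (signedInvolutions n)
      (fun π => (π.desNat, π.idesNat)) (fun π => (π.desR, π.idesR)) ∧
    involutionEulerianNat n = involutionEulerianR n ∧
    -- no equidistribution over the fixed-point-free signed involutions, unless there are none
    (Odd n → fixedPointFreeSignedInvolutions n = ∅) ∧
    (Even n →
      ¬ Equidistributed (fixedPointFreeSignedInvolutions n)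
          (fun π => π.desNat) (fun π => π.desR) ∧
      ¬ Equidistributed (fixedPointFreeSignedInvolutions n)
          (fun π => (π.desNat, π.idesNat)) (fun π => (π.desR, π.idesR))) := by
  have hgroup := SignedPerm.equidistributed_des_prod_ides n
  have hinvolutions := SignedPerm.equidistributed_des_signedInvolutions n
  have hnot := SignedPerm.not_equidistributed_des_fixedPointFreeSignedInvolutions hn
  exact ⟨hgroup, hgroup.sum_comp_eq fun d => MvPolynomial.X 0 ^ d.1 * MvPolynomial.X 1 ^ d.2,
    hinvolutions, SignedPerm.equidistributed_des_prod_ides_signedInvolutions n,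
    hinvolutions.sum_comp_eq fun d => Polynomial.X ^ d,
    SignedPerm.fixedPointFreeSignedInvolutions_eq_empty,
    fun he => ⟨hnot he, fun h => hnot he (h.comp Prod.fst)⟩⟩
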